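/- Let $\mathbb{F}$ be a field, let $\Gamma$ be a Boolean constraint language (a set of relations $R\subseteq\{0,1\}^k$ of various arities $k$), and let $\mathcal{C}$ be an instance of $\mathrm{CSP}(\Gamma)$ on the variables $x_1,\dots,x_n$, that is, a set of constraints $R(x_{i_1},\dots,x_{i_k})$ with $R\in\Gamma$. Let $Sol(\mathcal{C})\subseteq\{0,1\}^n$ be the (possibly empty) set of assignments satisfying all the constraints, and let $I_{\mathcal{C}}\subseteq\mathbb{F}[x_1,\dots,x_n]$ be the combinatorial ideal of $\mathcal{C}$: the ideal of all polynomials that vanish on $Sol(\mathcal{C})\subseteq\{0,1\}^n\subseteq\mathbb{F}^n$. Order monomials by the graded lexicographic order with $x_1>\dots>x_n$. A Gröbner basis of an ideal $I$ is a finite set $G\subseteq I$ whose leading terms generate the ideal generated by the leading terms of the nonzero elements of $I$ (so $\emptyset$ is one if $I=\{0\}$); it is reduced if every $g\in G$ has leading coefficient $1$ and no monomial of $g$ lies in the ideal generated by the leading terms of $G\setminus\{g\}$. Put $$\mathcal{T}^+=\Big\{\alpha\prod_{i\in S_1}x_i+\beta\prod_{i\in S_2}x_i \;\Big|\; S_1,S_2\subseteq[n],\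 \alpha,\beta\in\{0,\pm1\}\Big\}\cup\{\pm(x_i^2-x_i)\mid i\in[n]\},$$ $$\mathcal{T}^-=\Big\{\alpha\prod_{i\in S_1}(x_i-1)+\beta\prod_{i\in S_2}(x_i-1) \;\Big|\; S_1,S_2\subseteq[n],\ \alpha,\beta\in\{0,\pm1\}\Big\}\cup\{\pm(x_i^2-x_i)\mid i\in[n]\},$$ where empty products are $1$. If the binary operation $\mathrm{Max}$ on $\{0,1\}$ is a polymorphism of $\Gamma$ (every relation of $\Gamma$ is closed under coordinatewise $\mathrm{Max}$), then the (unique) reduced Gröbner basis of $I_{\mathcal{C}}$ exists and is a subset of $\mathcal{T}^-$. If the binary operation $\mathrm{Min}$ on $\{0,1\}$ is a polymorphism of $\Gamma$, then the (unique) reduced Gröbner basis of $I_{\mathcal{C}}$ exists and is a subset of $\mathcal{T}^+$. -/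

import Mathlib

open MvPolynomial

noncomputable section

/-! ### Constraint languages, instances and polymorphisms -/

/-- A constraint language over `D`: a set of relations over `D`, each with its own arity `k`. -/
abbrev ConstraintLanguage (D : Type*) := Set (Σ k : ℕ, Set (Fin k → D))

/-- An operation `f : D ^ m → D` is a polymorphism of a relation `R ⊆ D ^ k` if applying `f`
coordinatewise to any `m` tuples of `R` gives a tuple of `R`. -/
def IsPolymorphism {D : Type*} {m k : ℕ} (f : (Fin m → D) → D) (R : Set (Fin k → D)) : Prop :=
  ∀ t : Fin m → Fin k → D, (∀ i, t i ∈ R) → (fun j => f (fun i => t i j)) ∈ R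

/-- `Pol(Γ)`: the operations (of any arity) that are polymorphisms of every relation of `Γ`. -/
def Pol {D : Type*} (Γ : ConstraintLanguage D) : Set (Σ m : ℕ, ((Fin m → D) → D)) :=
  {f | ∀ R ∈ Γ, IsPolymorphism f.2 R.2}

/-- A constraint `R(x_{i_1}, …, x_{i_k})` over `Γ` with variables among `x_1, …, x_n`. -/
structure CSPConstraint {D : Type*} (Γ : ConstraintLanguage D) (n : ℕ) where
  /-- the relation, with its arity -/
  rel : Σ k : ℕ, Set (Fin k → D)
  rel_mem : rel ∈ Γ
  /-- the tuple of (indices of) variables -/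
  scope : Fin rel.1 → Fin n

/-- An instance of `CSP(Γ)` on the variables `x_1, …, x_n` is its set of constraints. -/
structure CSPInstance {D : Type*} (Γ : ConstraintLanguage D) (n : ℕ) where
  constraints : Set (CSPConstraint Γ n)

/-- `Sol(𝒞)`: the assignments that satisfy all the constraints. -/
def CSPInstance.Sol {D : Type*} {Γ : ConstraintLanguage D} {n : ℕ} (I : CSPInstance Γ n) :
    Set (Fin n → D) :=
  {φ | ∀ c ∈ I.constraints, (fun j => φ (c.scope j)) ∈ c.rel.2}

/-- The binary operation `Max` on `{0, 1}`. -/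
def maxOp : Σ m : ℕ, ((Fin m → Fin 2) → Fin 2) := ⟨2, fun a => max (a 0) (a 1)⟩

/-- The binary operation `Min` on `{0, 1}`. -/
def minOp : Σ m : ℕ, ((Fin m → Fin 2) → Fin 2) := ⟨2, fun a => min (a 0) (a 1)⟩

/-- The combinatorial ideal of a Boolean instance: the polynomials that vanish on `Sol(𝒞)`,
where `{0, 1}` is regarded as a subset of the field `F`. -/
def combinatorialIdeal (F : Type*) [Field F] {Γ : ConstraintLanguage (Fin 2)} {n : ℕ}
    (I : CSPInstance Γ n) : Ideal (MvPolynomial (Fin n) F) :=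
  vanishingIdeal F ((fun φ : Fin n → Fin 2 => fun i => (((φ i : Fin 2) : ℕ) : F)) '' I.Sol)

/-! ### Gröbner bases -/

/-- A finite subset `G` of the ideal `I` whose leading terms generate the ideal of the leading
terms of the nonzero elements of `I`. -/
def IsGroebnerBasis {σ F : Type*} [Field F] (m : MonomialOrder σ)
    (I : Ideal (MvPolynomial σ F)) (G : Finset (MvPolynomial σ F)) : Prop :=
  (G : Set (MvPolynomial σ F)) ⊆ I ∧
    Ideal.span (m.leadingTerm '' (G : Set (MvPolynomial σ F))) =
      Ideal.span (m.leadingTerm '' {f | f ∈ I ∧ f ≠ 0})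

/-- A Gröbner basis `G` such that every `g ∈ G` has leading coefficient `1` and no monomial of
`g` lies in the ideal generated by the leading terms of `G \ {g}`. -/
def IsReducedGroebnerBasis {σ F : Type*} [Field F] (m : MonomialOrder σ)
    (I : Ideal (MvPolynomial σ F)) (G : Finset (MvPolynomial σ F)) : Prop :=
  IsGroebnerBasis m I G ∧
    (∀ g ∈ G, m.leadingCoeff g = 1) ∧
    ∀ g ∈ G, ∀ d ∈ g.support,
      monomial d (1 : F) ∉
        Ideal.span (m.leadingTerm '' ((G : Set (MvPolynomial σ F)) \ {g}))

/-! ### Two-terms polynomials -/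

/-- The positive terms `α ∏_{i ∈ S} x_i` with `S ⊆ [n]`, `α ∈ {0, 1, -1}`. -/
def positiveTerms (F : Type*) [Field F] (n : ℕ) : Set (MvPolynomial (Fin n) F) :=
  {p | ∃ (S : Finset (Fin n)) (α : F), (α = 0 ∨ α = 1 ∨ α = -1) ∧ p = C α * ∏ i ∈ S, X i}

/-- The negative terms `α ∏_{i ∈ S} (x_i - 1)` with `S ⊆ [n]`, `α ∈ {0, 1, -1}`. -/
def negativeTerms (F : Type*) [Field F] (n : ℕ) : Set (MvPolynomial (Fin n) F) :=
  {p | ∃ (S : Finset (Fin n)) (α : F), (α = 0 ∨ α = 1 ∨ α = -1) ∧ p = C α * ∏ i ∈ S, (X i - 1)}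

/-- The polynomials `±(x_i ^ 2 - x_i)`. -/
def booleanPolys (F : Type*) [Field F] (n : ℕ) : Set (MvPolynomial (Fin n) F) :=
  {p | ∃ i : Fin n, p = X i ^ 2 - X i ∨ p = -(X i ^ 2 - X i)}

/-- `𝒯⁺`: the positive 2-terms polynomials. -/
def positiveTwoTerms (F : Type*) [Field F] (n : ℕ) : Set (MvPolynomial (Fin n) F) :=
  {p | ∃ s ∈ positiveTerms F n, ∃ t ∈ positiveTerms F n, p = s + t} ∪ booleanPolys F n

/-- `𝒯⁻`: the negative 2-terms polynomials. -/
def negativeTwoTerms (F : Type*) [Field F] (n : ℕ) : Set (MvPolynomial (Fin n) F) :=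
  {p | ∃ s ∈ negativeTerms F n, ∃ t ∈ negativeTerms F n, p = s + t} ∪ booleanPolys F n

end

/-! Call an exponent standard if it is not the leading exponent of a nonzero element of the ideal
`I`. The reduced Gröbner basis consists of one polynomial for each minimal leading exponent `d`: the
monic one whose other exponents are all standard (`isReducedGroebnerBasis_iff`).

Let `β` be 1 for Max and 0 for Min, and rewrite such a polynomial in products of powers of `X i -
β`. The exponents other than `d` stay standard, because standard exponents are closed under passing
to divisors. On solutions each product is, up to sign, the indicator of the solutions that differ
from `β` on its support. The polymorphism gives every nonempty set of this kind a least point, which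
makes distinct such sets have linearly independent indicators
(`eq_zero_of_sum_mul_indicator_eq_zero`). Distinct standard exponents give distinct nonempty sets,
so a relation led by `d` has at most one further term, with coefficient `1` or `-1`
(`IsReducedAt.eq_shiftedMonomial_or`). If `d` is not squarefree, the element is `X i ^ 2 - X i`. No
property special to the graded lexicographic order is used. -/

/-! ### Leading exponents and reduced Gröbner bases -/

section ReducedGroebnerBasis

variable {σ F : Type*} [Field F] {m : MonomialOrder σ} {I : Ideal (MvPolynomial σ F)}

/-- The exponents of the leading monomials of the nonzero elements of `I`. -/
def leadingExponents (m : MonomialOrder σ) (I : Ideal (MvPolynomial σ F)) : Set (σ →₀ ℕ) :=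
  m.degree '' {f | f ∈ I ∧ f ≠ 0}

theorem span_leadingTerm_image {A : Set (MvPolynomial σ F)} (hA : ∀ f ∈ A, f ≠ 0) :
    Ideal.span (m.leadingTerm '' A) =
      Ideal.span ((fun d => monomial d (1 : F)) '' (m.degree '' A)) := by
  apply le_antisymm <;> rw [Ideal.span_le]
  · rintro _ ⟨f, hf, rfl⟩
    have : m.leadingTerm f = C (m.leadingCoeff f) * monomial (m.degree f) 1 := by
      rw [C_mul_monomial, mul_one]; rfl
    rw [this]
    exact Ideal.mul_mem_left _ _ (Ideal.subset_span ⟨_, ⟨f, hf, rfl⟩, rfl⟩)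
  · rintro _ ⟨_, ⟨f, hf, rfl⟩, rfl⟩
    have : monomial (m.degree f) (1 : F) = C (m.leadingCoeff f)⁻¹ * m.leadingTerm f := by
      rw [MonomialOrder.leadingTerm, C_mul_monomial, inv_mul_cancel₀]
      exact MonomialOrder.leadingCoeff_ne_zero_iff.mpr (hA f hf)
    simp only [this]
    exact Ideal.mul_mem_left _ _ (Ideal.subset_span ⟨f, hf, rfl⟩)

theorem monomial_mem_span_leadingTerm_iff {A : Set (MvPolynomial σ F)} (hA : ∀ f ∈ A, f ≠ 0)
    {d : σ →₀ ℕ} :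
    monomial d (1 : F) ∈ Ideal.span (m.leadingTerm '' A) ↔ ∃ f ∈ A, m.degree f ≤ d := by
  classical
  rw [span_leadingTerm_image hA, mem_ideal_span_monomial_image, support_monomial,
    if_neg one_ne_zero]
  simp

theorem leadingExponents_upper {d e : σ →₀ ℕ} (hd : d ∈ leadingExponents m I) (hde : d ≤ e) :
    e ∈ leadingExponents m I := by
  obtain ⟨f, ⟨hf, hf0⟩, rfl⟩ := hd
  have h1 : monomial (e - m.degree f) (1 : F) ≠ 0 := by simp
  refine ⟨monomial (e - m.degree f) 1 * f, ⟨I.mul_mem_left _ hf, mul_ne_zero h1 hf0⟩, ?_⟩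
  classical
  rw [MonomialOrder.degree_mul h1 hf0, MonomialOrder.degree_monomial, if_neg one_ne_zero,
    tsub_add_cancel_of_le hde]

theorem monomial_mem_span_leadingTerm_ideal_iff {d : σ →₀ ℕ} :
    monomial d (1 : F) ∈ Ideal.span (m.leadingTerm '' {f | f ∈ I ∧ f ≠ 0}) ↔
      d ∈ leadingExponents m I := by
  rw [monomial_mem_span_leadingTerm_iff fun f hf => hf.2]
  exact ⟨fun ⟨f, hf, hd⟩ => leadingExponents_upper ⟨f, hf, rfl⟩ hd,
    fun ⟨f, hf, hd⟩ => ⟨f, hf, hd.le⟩⟩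

/-- An element of an ideal none of whose monomials is a leading monomial is zero. -/
theorem eq_zero_of_support_disjoint_leadingExponents {f : MvPolynomial σ F} (hf : f ∈ I)
    (h : ∀ e ∈ f.support, e ∉ leadingExponents m I) : f = 0 := by
  by_contra hf0
  exact h _ (m.degree_mem_support hf0) ⟨f, ⟨hf, hf0⟩, rfl⟩

/-- `g` is the monic element of `I` with leading exponent `d` all of whose other exponents are
standard. -/
structure IsReducedAt (m : MonomialOrder σ) (I : Ideal (MvPolynomial σ F)) (d : σ →₀ ℕ)
    (g : MvPolynomial σ F) : Prop where
  mem : g ∈ I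
  coeff_eq_one : g.coeff d = 1
  eq_of_mem : ∀ e ∈ g.support, e ∈ leadingExponents m I → e = d

/-- The exponent `d` cancels in the difference, which leaves an element of `I` with standard
exponents only. -/
theorem IsReducedAt.eq {d : σ →₀ ℕ} {g g' : MvPolynomial σ F} (h : IsReducedAt m I d g)
    (h' : IsReducedAt m I d g') : g = g' := by
  rw [← sub_eq_zero]
  refine eq_zero_of_support_disjoint_leadingExponents (m := m) (I.sub_mem h.mem h'.mem) ?_
  intro e he heL
  have hne : e ≠ d := by
    rintro rfl
    simp [h.coeff_eq_one, h'.coeff_eq_one] at he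
  classical
  rcases Finset.mem_union.mp (support_sub _ _ _ he) with h1 | h1
  · exact hne (h.eq_of_mem e h1 heL)
  · exact hne (h'.eq_of_mem e h1 heL)

theorem IsReducedAt.ne_zero {d : σ →₀ ℕ} {g : MvPolynomial σ F} (h : IsReducedAt m I d g) :
    g ≠ 0 := by
  rintro rfl
  simpa using h.coeff_eq_one

theorem IsReducedAt.degree_eq {d : σ →₀ ℕ} {g : MvPolynomial σ F} (h : IsReducedAt m I d g) :
    m.degree g = d :=
  h.eq_of_mem _ (m.degree_mem_support h.ne_zero) ⟨g, ⟨h.mem, h.ne_zero⟩, rfl⟩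

theorem exists_isReducedAt {d : σ →₀ ℕ} (hd : d ∈ leadingExponents m I) :
    ∃ g, IsReducedAt m I d g := by
  -- Dividing by all nonzero elements of `I` at once leaves a remainder with standard exponents
  -- only.
  obtain ⟨q, r, hqr, -, hr⟩ := m.div_set (B := {f | f ∈ I ∧ f ≠ 0})
    (fun b hb => (MonomialOrder.leadingCoeff_ne_zero_iff.mpr hb.2).isUnit) (monomial d (1 : F))
  have hr' : ∀ c ∈ r.support, c ∉ leadingExponents m I := by
    rintro c hc ⟨b, hb, rfl⟩
    exact hr _ hc b hb le_rfl
  have hdr : r.coeff d = 0 := by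
    by_contra h
    exact hr' d (mem_support_iff.mpr h) hd
  refine ⟨monomial d 1 - r, ?_, by classical simp [hdr, coeff_monomial], ?_⟩
  · rw [hqr, add_sub_cancel_right, Finsupp.linearCombination_apply]
    exact I.sum_mem fun b _ => I.mul_mem_left _ b.2.1
  · intro e he heL
    classical
    rcases Finset.mem_union.mp (support_sub _ _ _ he) with h1 | h1
    · exact Finset.mem_singleton.mp (support_monomial_subset h1)
    · exact absurd heL (hr' e h1)

theorem isReducedGroebnerBasis_iff {G : Finset (MvPolynomial σ F)} :
    IsReducedGroebnerBasis m I G ↔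
      ∀ g, g ∈ G ↔ ∃ d, Minimal (· ∈ leadingExponents m I) d ∧ IsReducedAt m I d g := by
  constructor
  · rintro ⟨⟨hGI, hspan⟩, hmonic, hred⟩
    have hne : ∀ g ∈ (G : Set (MvPolynomial σ F)), g ≠ 0 := by
      rintro g hg rfl
      simpa using hmonic 0 hg
    have hlead : ∀ d, d ∈ leadingExponents m I ↔ ∃ g ∈ G, m.degree g ≤ d := fun d => by
      rw [← monomial_mem_span_leadingTerm_ideal_iff, ← hspan,
        monomial_mem_span_leadingTerm_iff hne]
      simp
    have huniq : ∀ g ∈ G, ∀ d ∈ g.support, ∀ g' ∈ G, m.degree g' ≤ d → g' = g := by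
      intro g hg d hd g' hg' hle
      by_contra h
      exact hred g hg d hd ((monomial_mem_span_leadingTerm_iff fun f hf => hne f hf.1).mpr
        ⟨g', ⟨hg', h⟩, hle⟩)
    have hat : ∀ g ∈ G, Minimal (· ∈ leadingExponents m I) (m.degree g) ∧
        IsReducedAt m I (m.degree g) g := by
      intro g hg
      refine ⟨⟨⟨g, ⟨hGI hg, hne g hg⟩, rfl⟩, fun e he hle => ?_⟩, hGI hg, hmonic g hg, ?_⟩
      · obtain ⟨g', hg', hle'⟩ := (hlead e).mp he
        rw [huniq g hg _ (m.degree_mem_support (hne g hg)) g' hg' (hle'.trans hle)] at hle'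
        exact hle'
      · intro e he heL
        obtain ⟨g', hg', hle'⟩ := (hlead e).mp heL
        rw [huniq g hg e he g' hg' hle'] at hle'
        exact m.toSyn.injective (le_antisymm (m.le_degree he) (m.toSyn_monotone hle'))
    refine fun g => ⟨fun hg => ⟨_, hat g hg⟩, ?_⟩
    rintro ⟨d, hdmin, hd⟩
    obtain ⟨g', hg', hle⟩ := (hlead d).mp hdmin.prop
    have hdeg := hdmin.eq_of_le (hat g' hg').1.prop hle
    rw [hd.eq (hdeg ▸ (hat g' hg').2)]
    exact hg'
  · intro hG
    have hne : ∀ g ∈ (G : Set (MvPolynomial σ F)), g ≠ 0 := fun g hg =>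
      let ⟨_, _, h⟩ := (hG g).mp hg; h.ne_zero
    refine ⟨⟨fun g hg => let ⟨_, _, h⟩ := (hG g).mp hg; h.mem, ?_⟩, ?_, ?_⟩
    · apply le_antisymm
      · exact Ideal.span_mono (Set.image_mono fun g hg =>
          let ⟨_, _, h⟩ := (hG g).mp hg; ⟨h.mem, h.ne_zero⟩)
      · rw [span_leadingTerm_image (fun f hf => hf.2), Ideal.span_le]
        rintro _ ⟨e, he, rfl⟩
        obtain ⟨d, hde, hd⟩ := exists_minimal_le_of_wellFoundedLT
          (· ∈ leadingExponents m I) e he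
        obtain ⟨g, hg⟩ := exists_isReducedAt hd.prop
        exact (monomial_mem_span_leadingTerm_iff hne).mpr
          ⟨g, (hG g).mpr ⟨d, hd, hg⟩, hg.degree_eq.le.trans hde⟩
    · intro g hg
      obtain ⟨d, -, h⟩ := (hG g).mp hg
      rw [MonomialOrder.leadingCoeff, h.degree_eq, h.coeff_eq_one]
    · intro g hg e he hmem
      obtain ⟨d, hd, h⟩ := (hG g).mp hg
      obtain ⟨g', ⟨hg', hne'⟩, hle⟩ :=
        (monomial_mem_span_leadingTerm_iff fun f hf => hne f hf.1).mp hmem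
      obtain ⟨d', hd', h'⟩ := (hG g').mp hg'
      rw [h'.degree_eq] at hle
      obtain rfl := h.eq_of_mem e he (leadingExponents_upper hd'.prop hle)
      obtain rfl := hd.eq_of_le hd'.prop hle
      exact hne' (h'.eq h)

theorem existsUnique_isReducedGroebnerBasis [Finite σ] (m : MonomialOrder σ)
    (I : Ideal (MvPolynomial σ F)) : ∃! G, IsReducedGroebnerBasis m I G := by
  classical
  -- Dickson's lemma: an antichain of exponents in finitely many variables is finite.
  have hfin : {d | Minimal (· ∈ leadingExponents m I) d}.Finite :=
    WellQuasiOrderedLE.finite_of_isAntichain (setOfPred_minimal_antichain _)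
  have hG : {g | ∃ d, Minimal (· ∈ leadingExponents m I) d ∧ IsReducedAt m I d g}.Finite := by
    refine Set.Finite.of_finite_image (f := m.degree) (hfin.subset ?_) ?_
    · rintro _ ⟨g, ⟨d, hd, h⟩, rfl⟩
      exact h.degree_eq ▸ hd
    · rintro g ⟨d, -, h⟩ g' ⟨d', -, h'⟩ hgg'
      rw [h.degree_eq, h'.degree_eq] at hgg'
      exact h.eq (hgg' ▸ h')
  refine ⟨hG.toFinset, isReducedGroebnerBasis_iff.mpr fun g => by simp, fun G' hG' => ?_⟩
  ext g
  rw [isReducedGroebnerBasis_iff.mp hG' g]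
  simp

end ReducedGroebnerBasis

/-! ### Products of powers of `X i - b` -/

section ShiftedMonomial

variable {σ F : Type*} [Fintype σ] [Field F]

/-- The product `∏ i, (X i - b) ^ d i`. -/
noncomputable def shiftedMonomial (b : F) (d : σ →₀ ℕ) : MvPolynomial σ F :=
  ∏ i, (X i - C b) ^ d i

theorem degree_shiftedMonomial (m : MonomialOrder σ) (b : F) (d : σ →₀ ℕ) :
    m.degree (shiftedMonomial b d) = d := by
  rw [shiftedMonomial, MonomialOrder.degree_prod
    fun i _ => pow_ne_zero _ (m.monic_X_sub_C i b).ne_zero]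
  simp_rw [MonomialOrder.degree_pow, MonomialOrder.degree_X_sub_C, Finsupp.smul_single,
    smul_eq_mul, mul_one]
  exact Finsupp.univ_sum_single d

theorem monic_shiftedMonomial (m : MonomialOrder σ) (b : F) (d : σ →₀ ℕ) :
    m.Monic (shiftedMonomial b d) :=
  MonomialOrder.Monic.prod fun i _ => (m.monic_X_sub_C i b).pow

theorem le_of_mem_support_shiftedMonomial {b : F} {d e : σ →₀ ℕ}
    (he : e ∈ (shiftedMonomial b d).support) : e ≤ d := by
  classical
  intro i
  refine (monomial_le_degreeOf i he).trans ((degreeOf_prod_le i _ _).trans ?_)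
  calc ∑ j, degreeOf i ((X j - C b : MvPolynomial σ F) ^ d j)
      ≤ ∑ j, if i = j then d j else 0 := Finset.sum_le_sum fun j _ => by
        refine (degreeOf_pow_le _ _ _).trans ?_
        have h : degreeOf i (X j - C b : MvPolynomial σ F) ≤ if i = j then 1 else 0 :=
          (degreeOf_sub_le _ _ _).trans (by simp [degreeOf_X, degreeOf_C])
        refine (Nat.mul_le_mul_left _ h).trans ?_
        split_ifs <;> simp
    _ = d i := by simp

theorem aeval_X_sub_C_eq_sum (b : F) (f : MvPolynomial σ F) :
    aeval (fun i => (X i - C b : MvPolynomial σ F)) f =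
      ∑ d ∈ f.support, C (f.coeff d) * shiftedMonomial b d := by
  rw [aeval_def, eval₂_eq']
  rfl

/-- Taylor expansion: `h` is `f` with each `X i` replaced by `X i + b`, and this substitution
creates only exponents below those of `f`. -/
theorem exists_eq_sum_shiftedMonomial (b : F) (f : MvPolynomial σ F) :
    ∃ h : MvPolynomial σ F, f = ∑ e ∈ h.support, C (h.coeff e) * shiftedMonomial b e ∧
      ∀ e ∈ h.support, ∃ d ∈ f.support, e ≤ d := by
  refine ⟨aeval (fun i => (X i - C (-b) : MvPolynomial σ F)) f, ?_, fun e he => ?_⟩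
  · rw [← aeval_X_sub_C_eq_sum, ← AlgHom.comp_apply, comp_aeval]
    simp
  · rw [aeval_X_sub_C_eq_sum] at he
    classical
    obtain ⟨d, hd, h⟩ := Finset.mem_biUnion.mp (support_sum he)
    rw [mem_support_iff, coeff_C_mul] at h
    exact ⟨d, hd, le_of_mem_support_shiftedMonomial
      (mem_support_iff.mpr (right_ne_zero_of_mul h))⟩

variable {m : MonomialOrder σ} {I : Ideal (MvPolynomial σ F)}

theorem IsReducedAt.exists_eq_shiftedMonomial_add_sum (b : F) {d : σ →₀ ℕ}
    {g : MvPolynomial σ F} (hd : Minimal (· ∈ leadingExponents m I) d)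
    (hg : IsReducedAt m I d g) :
    ∃ h : MvPolynomial σ F,
      g = shiftedMonomial b d + ∑ e ∈ h.support, C (h.coeff e) * shiftedMonomial b e ∧
      ∀ e ∈ h.support, e ∉ leadingExponents m I := by
  obtain ⟨h, hsum, hsupp⟩ := exists_eq_sum_shiftedMonomial b (g - shiftedMonomial b d)
  refine ⟨h, by rw [← hsum]; ring, fun e he heL => ?_⟩
  obtain ⟨e', he', hle⟩ := hsupp e he
  have heL' := leadingExponents_upper heL hle
  have hcoeff : (shiftedMonomial b d).coeff d = 1 := by
    simpa [degree_shiftedMonomial] using (monic_shiftedMonomial m b d).coeff_degree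
  -- Both polynomials have coefficient 1 at `d`, so it cancels. Any other leading exponent in the
  -- support is excluded by reducedness of `g` or by minimality of `d`.
  have hne : e' ≠ d := by
    rintro rfl
    simp [hg.coeff_eq_one, hcoeff] at he'
  classical
  rcases Finset.mem_union.mp (support_sub _ _ _ he') with h1 | h1
  · exact hne (hg.eq_of_mem e' h1 heL')
  · exact hne (hd.eq_of_ge heL' (le_of_mem_support_shiftedMonomial h1)).symm

theorem shiftedMonomial_not_mem {b : F} {e : σ →₀ ℕ} (he : e ∉ leadingExponents m I) :
    shiftedMonomial b e ∉ I := fun h =>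
  he ⟨_, ⟨h, (monic_shiftedMonomial m b e).ne_zero⟩, degree_shiftedMonomial m b e⟩

/-- Otherwise the larger of the two exponents would be the leading exponent of this element, hence
not standard. -/
theorem eq_of_shiftedMonomial_sub_mem {b c : F} {e e' : σ →₀ ℕ} (hc : c ≠ 0)
    (he : e ∉ leadingExponents m I) (he' : e' ∉ leadingExponents m I)
    (h : shiftedMonomial b e - C c * shiftedMonomial b e' ∈ I) : e = e' := by
  wlog hlt : m.toSyn e' < m.toSyn e generalizing e e' c
  · rcases (not_lt.mp hlt).eq_or_lt with heq | hlt
    · exact m.toSyn.injective heq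
    · refine (this (c := c⁻¹) (inv_ne_zero hc) he' he ?_ hlt).symm
      convert I.mul_mem_left (C (-c⁻¹)) h using 1
      rw [mul_sub, ← mul_assoc, ← C_mul, neg_mul, inv_mul_cancel₀ hc]
      simp only [map_neg, map_one]
      ring
  · have hdeg : m.degree (shiftedMonomial b e - C c * shiftedMonomial b e') = e := by
      rw [MonomialOrder.degree_sub_of_lt, degree_shiftedMonomial]
      rw [degree_shiftedMonomial, ← smul_eq_C_mul]
      refine (m.degree_smul_le).trans_lt ?_
      rwa [degree_shiftedMonomial]
    refine absurd ⟨_, ⟨h, fun h0 => ?_⟩, hdeg⟩ he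
    rw [h0, MonomialOrder.degree_zero] at hdeg
    subst hdeg
    exact (m.bot_eq_zero ▸ not_lt_bot : ¬ m.toSyn e' < 0) (by simpa using hlt)

end ShiftedMonomial

/-! ### Linear independence of indicators -/

/-- Indicators of distinct sets are linearly independent if each of these sets has a point that
belongs only to those sets of the family which contain it entirely. -/
theorem eq_zero_of_sum_mul_indicator_eq_zero {ι α F : Type*} [Field F] {T : Finset ι}
    {A : ι → Set α} {a : ι → F} (hinj : Set.InjOn A T)
    (hA : ∀ e ∈ T, ∃ c ∈ A e, ∀ e' ∈ T, c ∈ A e' → A e ⊆ A e')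
    (hsum : ∀ e ∈ T, ∀ x ∈ A e, ∑ e' ∈ T, a e' * (A e').indicator 1 x = 0) :
    ∀ e ∈ T, a e = 0 := by
  classical
  by_contra! hne
  obtain ⟨e₀, he₀, hae₀⟩ := hne
  -- Among the nonzero coefficients take one whose set is maximal: at its special point `c` every
  -- other term vanishes.
  obtain ⟨e, he, hmax⟩ := (T.filter (a · ≠ 0)).exists_maximalFor A
    ⟨e₀, Finset.mem_filter.mpr ⟨he₀, hae₀⟩⟩
  rw [Finset.mem_filter] at he
  obtain ⟨c, hc, hcA⟩ := hA e he.1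
  have h := hsum e he.1 c hc
  rw [Finset.sum_eq_single_of_mem e he.1, Set.indicator_of_mem hc] at h
  · exact he.2 (by simpa using h)
  · intro e' he' hne
    by_cases hae : a e' = 0
    · rw [hae, zero_mul]
    · rw [Set.indicator_of_notMem, mul_zero]
      intro hce'
      have hsub := hcA e' he' hce'
      exact hne (hinj he' he.1
        ((hmax (Finset.mem_filter.mpr ⟨he', hae⟩) hsub).antisymm hsub))

/-! ### Ideals of sets of Boolean points -/

section BooleanPoints

variable {σ F : Type*} [Field F]

/-- The ideal of the polynomials that vanish on a set of Boolean points. -/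
noncomputable def booleanVanishingIdeal (F : Type*) [Field F] (S : Set (σ → Fin 2)) :
    Ideal (MvPolynomial σ F) :=
  vanishingIdeal F ((fun φ : σ → Fin 2 => fun i => (((φ i : Fin 2) : ℕ) : F)) '' S)

theorem mem_booleanVanishingIdeal_iff {S : Set (σ → Fin 2)} {f : MvPolynomial σ F} :
    f ∈ booleanVanishingIdeal F S ↔ ∀ φ ∈ S, aeval (fun i => ((φ i : ℕ) : F)) f = 0 := by
  rw [booleanVanishingIdeal, mem_vanishingIdeal_iff, Set.forall_mem_image]

/-- The points of `S` that differ from `β` at all the indices which occur in `e`. -/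
def avoidingPoints (S : Set (σ → Fin 2)) (β : Fin 2) (e : σ →₀ ℕ) : Set (σ → Fin 2) :=
  {φ | φ ∈ S ∧ ∀ i ∈ e.support, φ i ≠ β}

/-- The difference of the element of `{0, 1}` other than `β` and `β`. -/
def booleanSign (F : Type*) [Field F] (β : Fin 2) : F := 1 - 2 * ((β : ℕ) : F)

theorem booleanSign_pow_eq (β : Fin 2) (k : ℕ) :
    booleanSign F β ^ k = 1 ∨ booleanSign F β ^ k = -1 := by
  fin_cases β
  · left; simp [booleanSign]
  · have : booleanSign F 1 = -1 := by simp [booleanSign]; ring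
    simpa [this] using neg_one_pow_eq_or F k

theorem booleanSign_pow_ne_zero (β : Fin 2) (k : ℕ) : booleanSign F β ^ k ≠ 0 := by
  rcases booleanSign_pow_eq (F := F) β k with h | h <;> simp [h]

theorem cast_sub_cast_eq_booleanSign {x β : Fin 2} (h : x ≠ β) :
    ((x : ℕ) : F) - ((β : ℕ) : F) = booleanSign F β := by
  fin_cases x <;> fin_cases β <;> simp_all [booleanSign]
  ring

theorem X_sq_sub_X_mem_booleanVanishingIdeal (S : Set (σ → Fin 2)) (i : σ) :
    (X i ^ 2 - X i : MvPolynomial σ F) ∈ booleanVanishingIdeal F S := by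
  refine mem_booleanVanishingIdeal_iff.mpr fun φ _ => ?_
  simp only [map_sub, map_pow, aeval_X]
  generalize φ i = x
  fin_cases x <;> simp

variable {S : Set (σ → Fin 2)} {β : Fin 2} {m : MonomialOrder σ}

theorem single_two_mem_leadingExponents (i : σ) :
    Finsupp.single i 2 ∈ leadingExponents m (booleanVanishingIdeal F S) := by
  have h : (X i ^ 2 - X i : MvPolynomial σ F) = X i * (X i - C 1) := by rw [C_1]; ring
  have h0 := (m.monic_X_sub_C i (1 : F)).ne_zero
  refine ⟨X i ^ 2 - X i, ⟨X_sq_sub_X_mem_booleanVanishingIdeal _ i, ?_⟩, ?_⟩ <;> rw [h]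
  · exact mul_ne_zero (X_ne_zero i) h0
  · rw [MonomialOrder.degree_mul (X_ne_zero i) h0, MonomialOrder.degree_X,
      MonomialOrder.degree_X_sub_C, ← Finsupp.single_add]

theorem le_one_of_notMem_leadingExponents {e : σ →₀ ℕ}
    (he : e ∉ leadingExponents m (booleanVanishingIdeal F S)) (i : σ) : e i ≤ 1 := by
  by_contra h
  exact he (leadingExponents_upper (single_two_mem_leadingExponents i)
    (Finsupp.single_le_iff.mpr (not_le.mp h)))

theorem IsReducedAt.eq_X_sq_sub_X {d : σ →₀ ℕ} {g : MvPolynomial σ F} {i : σ}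
    (hd : Minimal (· ∈ leadingExponents m (booleanVanishingIdeal F S)) d)
    (hg : IsReducedAt m (booleanVanishingIdeal F S) d g) (hi : ¬ d i ≤ 1) :
    g = X i ^ 2 - X i := by
  -- Minimality forces `d` to be twice the unit exponent at `i`; it also excludes `X i` as a leading
  -- monomial.
  classical
  obtain rfl := hd.eq_of_le (single_two_mem_leadingExponents i)
    (Finsupp.single_le_iff.mpr (not_le.mp hi))
  have hne : Finsupp.single i 1 ≠ Finsupp.single i 2 :=
    fun h => absurd (Finsupp.single_injective i h) (by norm_num)
  have hX : (X i ^ 2 : MvPolynomial σ F) = monomial (Finsupp.single i 2) 1 := X_pow_eq_monomial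
  refine hg.eq ⟨X_sq_sub_X_mem_booleanVanishingIdeal _ i, ?_, fun e he heL => ?_⟩
  · rw [coeff_sub, hX, coeff_monomial, if_pos rfl, coeff_X, if_neg hne, sub_zero]
  · rcases Finset.mem_union.mp (support_sub _ _ _ he) with h1 | h1
    · rw [hX] at h1
      exact Finset.mem_singleton.mp (support_monomial_subset h1)
    · rw [support_X, Finset.mem_singleton] at h1
      subst h1
      exact hd.eq_of_le heL (Finsupp.single_le_single.mpr one_le_two)

variable [Fintype σ]

theorem aeval_shiftedMonomial {φ : σ → Fin 2} (hφ : φ ∈ S) (e : σ →₀ ℕ) :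
    aeval (fun i => ((φ i : ℕ) : F)) (shiftedMonomial ((β : ℕ) : F) e) =
      booleanSign F β ^ (∑ i, e i) * (avoidingPoints S β e).indicator 1 φ := by
  simp only [shiftedMonomial, map_prod, map_pow, map_sub, aeval_X, aeval_C,
    Algebra.algebraMap_self, RingHom.id_apply]
  by_cases h : ∀ i ∈ e.support, φ i ≠ β
  · rw [Set.indicator_of_mem (show φ ∈ avoidingPoints S β e from ⟨hφ, h⟩), Pi.one_apply, mul_one,
      ← Finset.prod_pow_eq_pow_sum]
    refine Finset.prod_congr rfl fun i _ => ?_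
    by_cases hi : i ∈ e.support
    · rw [cast_sub_cast_eq_booleanSign (h i hi)]
    · rw [Finsupp.notMem_support_iff.mp hi, pow_zero, pow_zero]
  · rw [Set.indicator_of_notMem fun h' => h h'.2, mul_zero]
    push Not at h
    obtain ⟨i, hi, hφi⟩ := h
    refine Finset.prod_eq_zero (Finset.mem_univ i) ?_
    rw [hφi, sub_self, zero_pow (Finsupp.mem_support_iff.mp hi)]

theorem avoidingPoints_nonempty {e : σ →₀ ℕ}
    (he : e ∉ leadingExponents m (booleanVanishingIdeal F S)) :
    (avoidingPoints S β e).Nonempty := by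
  by_contra h
  rw [Set.not_nonempty_iff_eq_empty] at h
  refine shiftedMonomial_not_mem (b := ((β : ℕ) : F)) he
    (mem_booleanVanishingIdeal_iff.mpr fun φ hφ => ?_)
  rw [aeval_shiftedMonomial hφ, h, Set.indicator_empty, mul_zero]

theorem eq_of_avoidingPoints_eq {e e' : σ →₀ ℕ}
    (he : e ∉ leadingExponents m (booleanVanishingIdeal F S))
    (he' : e' ∉ leadingExponents m (booleanVanishingIdeal F S))
    (h : avoidingPoints S β e = avoidingPoints S β e') : e = e' := by
  refine eq_of_shiftedMonomial_sub_mem (b := ((β : ℕ) : F))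
    -- This ratio of signs makes the two products agree on `S` once their indicators coincide.
    (c := booleanSign F β ^ (∑ i, e i) * (booleanSign F β ^ (∑ i, e' i))⁻¹)
    (mul_ne_zero (booleanSign_pow_ne_zero _ _) (inv_ne_zero (booleanSign_pow_ne_zero _ _)))
    he he' (mem_booleanVanishingIdeal_iff.mpr fun φ hφ => ?_)
  rw [map_sub, map_mul, aeval_shiftedMonomial hφ, aeval_shiftedMonomial hφ, aeval_C, h]
  have := booleanSign_pow_ne_zero (F := F) β (∑ i, e' i)
  simp only [Algebra.algebraMap_self, RingHom.id_apply]
  field_simp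
  ring

/-- If `S` is closed under an operation which intersects the sets of indices where points differ
from `β`, then each nonempty `avoidingPoints S β e` has a point at which this set of indices is
least. -/
theorem exists_least_avoidingPoint
    (hS : ∀ φ ∈ S, ∀ ψ ∈ S, ∃ χ ∈ S, ∀ i, χ i ≠ β ↔ φ i ≠ β ∧ ψ i ≠ β) {e : σ →₀ ℕ}
    (he : (avoidingPoints S β e).Nonempty) :
    ∃ c ∈ avoidingPoints S β e, ∀ e' : σ →₀ ℕ,
      c ∈ avoidingPoints S β e' → avoidingPoints S β e ⊆ avoidingPoints S β e' := by
  classical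
  obtain ⟨c, hc, hmin⟩ := (Set.toFinite (avoidingPoints S β e)).exists_minimalFor
    (fun φ => Finset.univ.filter (φ · ≠ β)) _ he
  refine ⟨c, hc, fun e' hce' ψ hψ => ⟨hψ.1, fun i hi => ?_⟩⟩
  -- Meeting `c` with `ψ` stays in the set, so minimality of `c` forces `ψ` to differ from `β`
  -- wherever `c` does.
  obtain ⟨χ, hχ, hχi⟩ := hS c hc.1 ψ hψ.1
  have hle := hmin (j := χ) ⟨hχ, fun j hj => (hχi j).mpr ⟨hc.2 j hj, hψ.2 j hj⟩⟩
    fun j hj => by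
      rw [Finset.mem_filter] at hj ⊢
      exact ⟨hj.1, ((hχi j).mp hj.2).1⟩
  have := hle (Finset.mem_filter.mpr ⟨Finset.mem_univ i, hce'.2 i hi⟩)
  exact ((hχi i).mp (Finset.mem_filter.mp this).2).2

theorem IsReducedAt.eq_shiftedMonomial_or
    (hS : ∀ φ ∈ S, ∀ ψ ∈ S, ∃ χ ∈ S, ∀ i, χ i ≠ β ↔ φ i ≠ β ∧ ψ i ≠ β) {d : σ →₀ ℕ}
    {g : MvPolynomial σ F}
    (hd : Minimal (· ∈ leadingExponents m (booleanVanishingIdeal F S)) d)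
    (hg : IsReducedAt m (booleanVanishingIdeal F S) d g) :
    g = shiftedMonomial ((β : ℕ) : F) d ∨
      ∃ e ∉ leadingExponents m (booleanVanishingIdeal F S), ∃ γ : F, (γ = 1 ∨ γ = -1) ∧
        g = shiftedMonomial ((β : ℕ) : F) d + C γ * shiftedMonomial ((β : ℕ) : F) e := by
  classical
  obtain ⟨h, hgh, hstd⟩ := hg.exists_eq_shiftedMonomial_add_sum ((β : ℕ) : F) hd
  have hzero : ∀ φ ∈ S, booleanSign F β ^ (∑ i, d i) * (avoidingPoints S β d).indicator 1 φ +
      ∑ e ∈ h.support, h.coeff e * booleanSign F β ^ (∑ i, e i) *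
        (avoidingPoints S β e).indicator 1 φ = 0 := by
    intro φ hφ
    have := mem_booleanVanishingIdeal_iff.mp hg.mem φ hφ
    rw [hgh, map_add, map_sum, aeval_shiftedMonomial hφ] at this
    simpa only [map_mul, aeval_shiftedMonomial hφ, aeval_C, Algebra.algebraMap_self,
      RingHom.id_apply, mul_assoc] using this
  have hinj : Set.InjOn (avoidingPoints S β) (h.support : Set (σ →₀ ℕ)) :=
    fun e he e' he' hee' => eq_of_avoidingPoints_eq (hstd e he) (hstd e' he') hee'
  have hleast : ∀ e ∈ h.support, ∃ c ∈ avoidingPoints S β e, ∀ e' ∈ h.support,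
      c ∈ avoidingPoints S β e' → avoidingPoints S β e ⊆ avoidingPoints S β e' := fun e he =>
    let ⟨c, hc, h⟩ := exists_least_avoidingPoint hS (avoidingPoints_nonempty (hstd e he))
    ⟨c, hc, fun e' _ => h e'⟩
  rcases (avoidingPoints S β d).eq_empty_or_nonempty with hdempty | hdne
  -- The product for `d` vanishes on `S`, so independence kills all the other terms.
  · left
    have h0 := eq_zero_of_sum_mul_indicator_eq_zero hinj hleast
      (a := fun e => h.coeff e * booleanSign F β ^ (∑ i, e i))
      fun e _ φ hφ => by simpa [hdempty] using hzero φ hφ.1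
    rw [hgh, Finset.sum_eq_zero, add_zero]
    intro e he
    rw [(mul_eq_zero_iff_right (booleanSign_pow_ne_zero _ _)).mp (h0 e he), map_zero, zero_mul]
  · right
    by_cases hex : ∃ e ∈ h.support, avoidingPoints S β e = avoidingPoints S β d
    · obtain ⟨e, he, hed⟩ := hex
      -- The indicators for `d` and `e` coincide, so the term of `d` is absorbed into the
      -- coefficient at `e`.
      have h0 := eq_zero_of_sum_mul_indicator_eq_zero hinj hleast
        (a := fun e' => h.coeff e' * booleanSign F β ^ (∑ i, e' i) +
          if e' = e then booleanSign F β ^ (∑ i, d i) else 0)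
        fun e' _ φ hφ => by
          simp only [add_mul, Finset.sum_add_distrib, ite_mul, zero_mul, Finset.sum_ite_eq', he,
            if_true, hed]
          rw [add_comm]
          exact hzero φ hφ.1
      refine ⟨e, hstd e he, h.coeff e, ?_, ?_⟩
      · have := h0 e he
        rw [if_pos rfl] at this
        rcases booleanSign_pow_eq (F := F) β (∑ i, d i) with h1 | h1 <;>
        rcases booleanSign_pow_eq (F := F) β (∑ i, e i) with h2 | h2 <;>
        rw [h1, h2] at this
        · right; linear_combination this
        · left; linear_combination -this
        · left; linear_combination this
        · right; linear_combination -this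
      · rw [hgh, Finset.sum_eq_single_of_mem e he]
        intro e' he' hne
        have := h0 e' he'
        rw [if_neg hne, add_zero] at this
        rw [(mul_eq_zero_iff_right (booleanSign_pow_ne_zero _ _)).mp this, map_zero, zero_mul]
    -- The set of `d` is now nonempty and new, so adjoining it keeps independence, yet its
    -- coefficient is a nonzero sign.
    · exfalso
      push Not at hex
      have hdh : d ∉ h.support := fun hdh => hstd d hdh hd.prop
      have h0 := eq_zero_of_sum_mul_indicator_eq_zero (T := insert d h.support)
        (A := avoidingPoints S β)
        (a := fun e => if e = d then booleanSign F β ^ (∑ i, d i) else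
          h.coeff e * booleanSign F β ^ (∑ i, e i)) ?_ ?_ ?_ d (Finset.mem_insert_self _ _)
      · exact booleanSign_pow_ne_zero β _ ((if_pos rfl).symm.trans h0)
      · rw [Finset.coe_insert, Set.injOn_insert (by simpa using hdh)]
        refine ⟨hinj, ?_⟩
        rintro ⟨e, he, hed⟩
        exact hex e he hed
      · intro e he
        have hne : (avoidingPoints S β e).Nonempty := by
          rcases Finset.mem_insert.mp he with rfl | he
          · exact hdne
          · exact avoidingPoints_nonempty (hstd e he)
        obtain ⟨c, hc, h⟩ := exists_least_avoidingPoint hS hne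
        exact ⟨c, hc, fun e' _ => h e'⟩
      · intro e _ φ hφ
        rw [Finset.sum_insert hdh, if_pos rfl, ← hzero φ hφ.1]
        congr 1
        refine Finset.sum_congr rfl fun e' he' => ?_
        rw [if_neg (ne_of_mem_of_not_mem he' hdh)]

theorem shiftedMonomial_eq_prod_support {b : F} {d : σ →₀ ℕ} (hd : ∀ i, d i ≤ 1) :
    shiftedMonomial b d = ∏ i ∈ d.support, (X i - C b) := by
  rw [shiftedMonomial, ← Finset.prod_subset (Finset.subset_univ d.support)]
  · refine Finset.prod_congr rfl fun i hi => ?_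
    rw [le_antisymm (hd i) (Nat.one_le_iff_ne_zero.mpr (Finsupp.mem_support_iff.mp hi)), pow_one]
  · intro i _ hi
    rw [Finsupp.notMem_support_iff.mp hi, pow_zero]

/-- The shape of the elements of the reduced Gröbner basis. -/
theorem IsReducedGroebnerBasis.eq_two_terms_or
    (hS : ∀ φ ∈ S, ∀ ψ ∈ S, ∃ χ ∈ S, ∀ i, χ i ≠ β ↔ φ i ≠ β ∧ ψ i ≠ β)
    {G : Finset (MvPolynomial σ F)}
    (hG : IsReducedGroebnerBasis m (booleanVanishingIdeal F S) G) {g : MvPolynomial σ F}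
    (hg : g ∈ G) :
    (∃ (T U : Finset σ) (γ : F), (γ = 0 ∨ γ = 1 ∨ γ = -1) ∧
      g = ∏ i ∈ T, (X i - C ((β : ℕ) : F)) + C γ * ∏ i ∈ U, (X i - C ((β : ℕ) : F))) ∨
    ∃ i, g = X i ^ 2 - X i := by
  obtain ⟨d, hd, hgd⟩ := (isReducedGroebnerBasis_iff.mp hG g).mp hg
  by_cases hsq : ∀ i, d i ≤ 1
  · left
    rcases hgd.eq_shiftedMonomial_or hS hd with rfl | ⟨e, he, γ, hγ, rfl⟩
    · exact ⟨d.support, ∅, 0, .inl rfl, by simp [shiftedMonomial_eq_prod_support hsq]⟩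
    · exact ⟨d.support, e.support, γ, .inr hγ, by
        rw [shiftedMonomial_eq_prod_support hsq,
          shiftedMonomial_eq_prod_support (le_one_of_notMem_leadingExponents he)]⟩
  · right
    push Not at hsq
    obtain ⟨i, hi⟩ := hsq
    exact ⟨i, hgd.eq_X_sq_sub_X hd (not_le.mpr hi)⟩

end BooleanPoints

/-! ### Polymorphisms and solution sets -/

theorem CSPInstance.mem_Sol_of_mem_Pol {D : Type*} {Γ : ConstraintLanguage D} {n : ℕ}
    (I : CSPInstance Γ n) {f : Σ m : ℕ, ((Fin m → D) → D)} (hf : f ∈ Pol Γ)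
    (t : Fin f.1 → Fin n → D) (ht : ∀ i, t i ∈ I.Sol) : (fun j => f.2 fun i => t i j) ∈ I.Sol :=
  fun c hc => hf c.rel c.rel_mem (fun i j => t i (c.scope j)) fun i => ht i c hc

theorem mainTheorem7 (F : Type*) [Field F] (Γ : ConstraintLanguage (Fin 2)) (n : ℕ)
    (𝒞 : CSPInstance Γ n) :
    (maxOp ∈ Pol Γ →
      (∃! G, IsReducedGroebnerBasis MonomialOrder.degLex (combinatorialIdeal F 𝒞) G) ∧
      ∀ G, IsReducedGroebnerBasis MonomialOrder.degLex (combinatorialIdeal F 𝒞) G →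
        (G : Set (MvPolynomial (Fin n) F)) ⊆ negativeTwoTerms F n) ∧
    (minOp ∈ Pol Γ →
      (∃! G, IsReducedGroebnerBasis MonomialOrder.degLex (combinatorialIdeal F 𝒞) G) ∧
      ∀ G, IsReducedGroebnerBasis MonomialOrder.degLex (combinatorialIdeal F 𝒞) G →
        (G : Set (MvPolynomial (Fin n) F)) ⊆ positiveTwoTerms F n) := by
  refine ⟨fun hmax => ⟨existsUnique_isReducedGroebnerBasis _ _, fun G hG g hg => ?_⟩,
    fun hmin => ⟨existsUnique_isReducedGroebnerBasis _ _, fun G hG g hg => ?_⟩⟩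
  -- Max intersects the sets of zeros, so `β = 1`; dually, Min intersects the sets of ones, so `β =
  -- 0`.
  · have hS : ∀ φ ∈ 𝒞.Sol, ∀ ψ ∈ 𝒞.Sol, ∃ χ ∈ 𝒞.Sol,
        ∀ i, χ i ≠ (1 : Fin 2) ↔ φ i ≠ 1 ∧ ψ i ≠ 1 := fun φ hφ ψ hψ => by
      refine ⟨_, 𝒞.mem_Sol_of_mem_Pol hmax ![φ, ψ] (Fin.forall_fin_two.mpr ⟨hφ, hψ⟩),
        fun i => ?_⟩
      change max (φ i) (ψ i) ≠ 1 ↔ _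
      generalize φ i = x, ψ i = y
      decide +revert
    rcases IsReducedGroebnerBasis.eq_two_terms_or hS hG hg with ⟨T, U, γ, hγ, h⟩ | ⟨i, h⟩
    · refine .inl ⟨_, ⟨T, 1, .inr (.inl rfl), rfl⟩, _, ⟨U, γ, hγ, rfl⟩, ?_⟩
      simpa using h
    · exact .inr ⟨i, .inl h⟩
  · have hS : ∀ φ ∈ 𝒞.Sol, ∀ ψ ∈ 𝒞.Sol, ∃ χ ∈ 𝒞.Sol,
        ∀ i, χ i ≠ (0 : Fin 2) ↔ φ i ≠ 0 ∧ ψ i ≠ 0 := fun φ hφ ψ hψ => by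
      refine ⟨_, 𝒞.mem_Sol_of_mem_Pol hmin ![φ, ψ] (Fin.forall_fin_two.mpr ⟨hφ, hψ⟩),
        fun i => ?_⟩
      change min (φ i) (ψ i) ≠ 0 ↔ _
      generalize φ i = x, ψ i = y
      decide +revert
    rcases IsReducedGroebnerBasis.eq_two_terms_or hS hG hg with ⟨T, U, γ, hγ, h⟩ | ⟨i, h⟩
    · refine .inl ⟨_, ⟨T, 1, .inr (.inl rfl), rfl⟩, _, ⟨U, γ, hγ, rfl⟩, ?_⟩
      simpa using h
    · exact .inr ⟨i, .inl h⟩
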